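/- Let $T>0$, let $I=[x_a,x_b]$ with $x_a<x_b$, and let $g\in C([0,\infty),\mathbb R)$, $f\in C([0,T]\times I,\mathbb C)$ and $u_0\in C^2(I,\mathbb C)$ with $u_0(x_a)=u_0(x_b)=0$ (the data of the problem $u_t=\mathrm i\,u_{xx}+\mathrm i\,g(|u|^2)u+f$ with zero Dirichlet boundary values and $u(0,\cdot)=u_0$). Let $N,J\ge 1$ be integers, $\tau=T/N$, $t_n=n\tau$, $t^{1/2}=\tau/2$, $h=(x_b-x_a)/(J+1)$ and $x_j=x_a+jh$ for $j=0,\dots,J+1$. Let $\mathbb C_h$ be the space of vectors $(v_j)_{j=0}^{J+1}$ with complex entries and $\mathbb C_h^\circ=\{v\in\mathbb C_h: v_0=v_{J+1}=0\}$; let $\otimes$ be the entrywise product, and apply scalar functions to vectors entrywise. Let $\Delta_h:\mathbb C_h^\circ\to\mathbb C_h^\circ$ be given by $(\Delta_hv)_j=(v_{j-1}-2v_j+v_{j+1})/h^2$ for $1\le j\le J$; for a function $z$ on $I$ let $\overset{\circ}{\mathsf I}_hz\in\mathbb C_h^\circ$ have the entries $z(x_j)$ for $1\le j\le J$, and let $u^0=(u_0(x_j))_{j=0}^{J+1}$.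 The operator $\Delta_h$ is invertible; let $\mathsf R_h[u_0]\in\mathbb C_h^\circ$ be defined by $\Delta_h\mathsf R_h[u_0]=\overset{\circ}{\mathsf I}_h(u_0'')$. For $\delta>0$ let $p_\delta$ be the unique real polynomial of degree at most $7$ with $p_\delta(\delta)=\delta$, $p_\delta'(\delta)=1$, $p_\delta''(\delta)=p_\delta'''(\delta)=0$, $p_\delta(2\delta)=2\delta$, $p_\delta'(2\delta)=p_\delta''(2\delta)=p_\delta'''(2\delta)=0$; let $\mathfrak n_\delta:\mathbb R\to\mathbb R$ be the odd function with $\mathfrak n_\delta(x)=x$ on $[0,\delta]$, $\mathfrak n_\delta=p_\delta$ on $(\delta,2\delta]$ and $\mathfrak n_\delta(x)=2\delta$ for $x>2\delta$; and let $\gamma_\delta(z)=\mathfrak n_\delta(\operatorname{Re}z)+\mathrm i\,\mathfrak n_\delta(\operatorname{Im}z)$ for $z\in\mathbb C$. **Proposition (existence of the approximations of the modified relaxation finite difference (MRFD) scheme).** For every $\delta>0$, with no restriction on $\tau$ or $h$, the following holds. Put $V_\delta^0=\mathsf R_h[u_0]$. There is exactly one $V_\delta^{1/2}\in\mathbb C_h^\circ$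 with $$V_\delta^{1/2}-V_\delta^0=\mathrm i\tfrac\tau2\,\Delta_h\Big(\tfrac{V_\delta^{1/2}+V_\delta^0}2\Big)+\mathrm i\tfrac\tau2\,g(|u^0|^2)\otimes\tfrac{V_\delta^{1/2}+V_\delta^0}2+\tfrac\tau2\,\overset{\circ}{\mathsf I}_h\Big[\tfrac{f(t^{1/2},\cdot)+f(t_0,\cdot)}2\Big],$$ and there exist $V_\delta^1,\dots,V_\delta^N\in\mathbb C_h^\circ$ such that, for $n=0,\dots,N-1$, $$V_\delta^{n+1}-V_\delta^n=\mathrm i\tau\,\Delta_h\Big(\tfrac{V_\delta^{n+1}+V_\delta^n}2\Big)+\mathrm i\tau\,\mathfrak n_\delta\big(\Phi_\delta^{n+1/2}\big)\otimes\gamma_\delta\Big(\tfrac{V_\delta^{n+1}+V_\delta^n}2\Big)+\tau\,\overset{\circ}{\mathsf I}_h\Big[\tfrac{f(t_{n+1},\cdot)+f(t_n,\cdot)}2\Big],$$ where $\Phi_\delta^{1/2}=g\big(|\gamma_\delta(V_\delta^{1/2})|^2\big)$ and $\Phi_\delta^{n+1/2}=2\,g\big(|\gamma_\delta(V_\delta^n)|^2\big)-\Phi_\delta^{n-1/2}$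 for $n=1,\dots,N-1$. -/

import Mathlib

noncomputable section

namespace MRFD

open Polynomial

/-! ### Grid functions on a uniform partition of `[xa, xb]` with `J` interior nodes -/

/-- Mesh width `h = (xb - xa) / (J + 1)`. -/
def meshWidth (xa xb : ℝ) (J : ℕ) : ℝ := (xb - xa) / (J + 1)

/-- Nodes `x_j = xa + j h`. -/
def node (xa xb : ℝ) (J : ℕ) (j : Fin (J + 2)) : ℝ := xa + (j : ℕ) * meshWidth xa xb J

/-- The space of complex grid functions `(v_j)`, `j = 0, …, J + 1`. -/
abbrev Grid (J : ℕ) : Type := Fin (J + 2) → ℂ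

/-- The subspace of grid functions that vanish at both end points. -/
def Grid0 (J : ℕ) : Submodule ℂ (Grid J) where
  carrier := {v | v 0 = 0 ∧ v (Fin.last (J + 1)) = 0}
  add_mem' := by
    rintro v w ⟨h1, h2⟩ ⟨h3, h4⟩
    exact ⟨by simp [h1, h3], by simp [h2, h4]⟩
  zero_mem' := ⟨rfl, rfl⟩
  smul_mem' := by
    rintro c v ⟨h1, h2⟩
    exact ⟨by simp [h1], by simp [h2]⟩

/-- The grid function that takes the value `F j` at the interior nodes, and `0` at the ends. -/
def extendByZero {J : ℕ} (F : (j : Fin (J + 2)) → 0 < (j : ℕ) → (j : ℕ) < J + 1 → ℂ) : Grid0 J :=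
  ⟨fun j => if hj : 0 < (j : ℕ) ∧ (j : ℕ) < J + 1 then F j hj.1 hj.2 else 0, by
    constructor <;> simp⟩

/-- The discrete Laplacian `(Δ_h v)_j = (v_{j-1} - 2 v_j + v_{j+1}) / h²`, `j = 1, …, J`, as a
linear operator on the grid functions with zero boundary values. -/
def discLaplacian (J : ℕ) (h : ℝ) : Grid0 J →ₗ[ℂ] Grid0 J where
  toFun v := extendByZero fun j h0 h1 =>
    ((v : Grid J) ⟨(j : ℕ) - 1, by omega⟩ - 2 * (v : Grid J) j
      + (v : Grid J) ⟨(j : ℕ) + 1, by omega⟩) / (h : ℂ) ^ 2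
  map_add' v w := by
    ext j
    simp only [extendByZero, Submodule.coe_add, Pi.add_apply]
    split_ifs
    · ring
    · simp
  map_smul' c v := by
    ext j
    simp only [extendByZero, Submodule.coe_smul, Pi.smul_apply, smul_eq_mul, RingHom.id_apply]
    split_ifs
    · ring
    · simp

/-- Restriction of `z` to the nodes. -/
def interp (xa xb : ℝ) (J : ℕ) (z : ℝ → ℂ) : Grid J := fun j => z (node xa xb J j)

/-- Restriction of `z` to the interior nodes, with zero boundary values. -/
def interp0 (xa xb : ℝ) (J : ℕ) (z : ℝ → ℂ) : Grid0 J :=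
  extendByZero fun j _ _ => z (node xa xb J j)

lemma meshWidth_pos {xa xb : ℝ} (hab : xa < xb) (J : ℕ) : 0 < meshWidth xa xb J :=
  div_pos (sub_pos.2 hab) (by positivity)

/-- The discrete Laplacian is bijective. -/
lemma discLaplacian_bijective (J : ℕ) {h : ℝ} (hh : 0 < h) :
    Function.Bijective (discLaplacian J h) := by
  have hinj : Function.Injective (discLaplacian J h) := by
    rw [injective_iff_map_eq_zero]
    intro v hv
    have hv0 : (v : Grid J) 0 = 0 := v.2.1
    have hvl : (v : Grid J) (Fin.last (J + 1)) = 0 := v.2.2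
    have hrec : ∀ k (hk : k + 2 < J + 2), (v : Grid J) ⟨k + 2, hk⟩
        = 2 * (v : Grid J) ⟨k + 1, by omega⟩ - (v : Grid J) ⟨k, by omega⟩ := by
      intro k hk
      have h1 := congrFun (congrArg Subtype.val hv) ⟨k + 1, by omega⟩
      have hk' : k < J := by omega
      simp [discLaplacian, extendByZero, hk', hh.ne'] at h1
      linear_combination h1 (Nat.succ_pos k)
    have key : ∀ k, (∀ hk : k < J + 2, (v : Grid J) ⟨k, hk⟩ = k * (v : Grid J) ⟨1, by omega⟩) ∧
        (∀ hk : k + 1 < J + 2,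
          (v : Grid J) ⟨k + 1, hk⟩ = (k + 1) * (v : Grid J) ⟨1, by omega⟩) := by
      intro k
      induction k with
      | zero => exact ⟨fun _ => by simpa using hv0, fun _ => by simp⟩
      | succ k ih =>
        refine ⟨fun hk => by rw [ih.2 hk]; push_cast; ring, fun hk => ?_⟩
        rw [hrec k hk, ih.2 (by omega), ih.1 (by omega)]
        push_cast
        ring
    have h1 : (v : Grid J) ⟨1, by omega⟩ = 0 := by
      have h2 := (key J).2 (by omega)
      have h3 : (v : Grid J) ⟨J + 1, by omega⟩ = 0 := hvl
      rw [h3] at h2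
      have h4 : ((J : ℂ) + 1) ≠ 0 := by exact_mod_cast Nat.succ_ne_zero J
      exact (mul_eq_zero.1 h2.symm).resolve_left h4
    ext j
    have := (key j).1 j.2
    rw [h1, mul_zero] at this
    exact this
  exact ⟨hinj, LinearMap.injective_iff_surjective.1 hinj⟩

/-- The discrete elliptic projection `R_h[v]` of `v ∈ C²([xa, xb])`: the grid function with zero
boundary values such that `Δ_h (R_h[v])` is the restriction of `v''` to the interior nodes. -/
def ellipticProj {xa xb : ℝ} (hab : xa < xb) (J : ℕ) (v : ℝ → ℂ) : Grid0 J :=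
  (LinearEquiv.ofBijective (discLaplacian J (meshWidth xa xb J))
    (discLaplacian_bijective J (meshWidth_pos hab J))).symm
    (interp0 xa xb J (iteratedDerivWithin 2 v (Set.Icc xa xb)))

lemma discLaplacian_ellipticProj {xa xb : ℝ} (hab : xa < xb) (J : ℕ) (v : ℝ → ℂ) :
    discLaplacian J (meshWidth xa xb J) (ellipticProj hab J v)
      = interp0 xa xb J (iteratedDerivWithin 2 v (Set.Icc xa xb)) :=
  (LinearEquiv.ofBijective (discLaplacian J (meshWidth xa xb J))
    (discLaplacian_bijective J (meshWidth_pos hab J))).apply_symm_apply _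

/-! ### The mollifier -/

/-- The conditions that determine the transition polynomial of degree at most `7`. -/
structure IsTransition (δ : ℝ) (p : ℝ[X]) : Prop where
  natDegree_le : p.natDegree ≤ 7
  left0 : p.eval δ = δ
  left1 : (derivative p).eval δ = 1
  left2 : (derivative (derivative p)).eval δ = 0
  left3 : (derivative (derivative (derivative p))).eval δ = 0
  right0 : p.eval (2 * δ) = 2 * δ
  right1 : (derivative p).eval (2 * δ) = 0
  right2 : (derivative (derivative p)).eval (2 * δ) = 0
  right3 : (derivative (derivative (derivative p))).eval (2 * δ) = 0

lemma existsUnique_isTransition {δ : ℝ} (hδ : 0 < δ) : ∃! p : ℝ[X], IsTransition δ p := by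
  have hδ' := hδ.ne'
  refine existsUnique_of_exists_of_unique ?_ ?_
  · refine ⟨C δ * (1 + (C δ⁻¹ * X - 1) + (C δ⁻¹ * X - 1) ^ 4 *
      (-(C δ⁻¹ * X - 2) + 4 * (C δ⁻¹ * X - 2) ^ 2 - 10 * (C δ⁻¹ * X - 2) ^ 3)), ?_, ?_, ?_, ?_, ?_,
      ?_, ?_, ?_, ?_⟩
    · compute_degree
    all_goals
      simp [derivative_pow, hδ']
      try field_simp
      try norm_num
  · intro p q hp hq
    by_contra hne
    have hr : p - q ≠ 0 := sub_ne_zero.2 hne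
    have hdeg : (p - q).natDegree ≤ 7 :=
      (natDegree_sub_le p q).trans (max_le hp.natDegree_le hq.natDegree_le)
    have m1 : 3 < (p - q).rootMultiplicity δ := by
      rw [lt_rootMultiplicity_iff_isRoot_iterate_derivative hr]
      intro m hm
      interval_cases m <;> simp [IsRoot, hp.left0, hp.left1, hp.left2, hp.left3, hq.left0,
        hq.left1, hq.left2, hq.left3]
    have m2 : 3 < (p - q).rootMultiplicity (2 * δ) := by
      rw [lt_rootMultiplicity_iff_isRoot_iterate_derivative hr]
      intro m hm
      interval_cases m <;> simp [IsRoot, hp.right0, hp.right1, hp.right2, hp.right3, hq.right0,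
        hq.right1, hq.right2, hq.right3]
    have hle : Multiset.replicate 4 δ + Multiset.replicate 4 (2 * δ) ≤ (p - q).roots := by
      rw [Multiset.le_iff_count]
      intro a
      have hd : 2 * δ ≠ δ := by linarith
      rw [Multiset.count_add, count_roots, Multiset.count_replicate, Multiset.count_replicate]
      by_cases h1 : δ = a
      · subst h1; simp [hd]; omega
      · by_cases h2 : 2 * δ = a
        · subst h2; simp [h1]; omega
        · simp [h1, h2]
    have := (Multiset.card_le_card hle).trans (card_roots' _)
    simp at this
    omega

/-- The unique transition polynomial `p_δ`. -/
def transitionPoly {δ : ℝ} (hδ : 0 < δ) : ℝ[X] := (existsUnique_isTransition hδ).exists.choose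

lemma isTransition_transitionPoly {δ : ℝ} (hδ : 0 < δ) : IsTransition δ (transitionPoly hδ) :=
  (existsUnique_isTransition hδ).exists.choose_spec

/-- The values of the cut-off function for `x ≥ 0`. -/
def cutoffPos {δ : ℝ} (hδ : 0 < δ) (x : ℝ) : ℝ :=
  if x ≤ δ then x else if x ≤ 2 * δ then (transitionPoly hδ).eval x else 2 * δ

/-- The odd cut-off function `𝔫_δ : ℝ → ℝ`. -/
def cutoff {δ : ℝ} (hδ : 0 < δ) (x : ℝ) : ℝ :=
  if 0 ≤ x then cutoffPos hδ x else -cutoffPos hδ (-x)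

/-- The complex mollifier `γ_δ(z) = 𝔫_δ(Re z) + i 𝔫_δ(Im z)`. -/
def mollifier {δ : ℝ} (hδ : 0 < δ) (z : ℂ) : ℂ :=
  (cutoff hδ z.re : ℂ) + Complex.I * (cutoff hδ z.im : ℂ)

/-! ### The modified relaxation finite difference scheme -/

/-- The defining equation of `V^{1/2}` (unknown `Vh`), given `V⁰`, with time step `τ`. -/
def HalfStepEq (xa xb : ℝ) (J : ℕ) (g : ℝ → ℝ) (f : ℝ → ℝ → ℂ) (u₀ : ℝ → ℂ) (τ : ℝ)
    (V0 Vh : Grid0 J) : Prop :=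
  (Vh : Grid J) - (V0 : Grid J)
    = (Complex.I * (τ / 2 : ℂ)) •
        (discLaplacian J (meshWidth xa xb J) ((1 / 2 : ℂ) • (Vh + V0)) : Grid J)
      + (Complex.I * (τ / 2 : ℂ)) •
        ((fun j => (g (‖interp xa xb J u₀ j‖ ^ 2) : ℂ)) * ((1 / 2 : ℂ) • (Vh + V0) : Grid0 J))
      + (τ / 2 : ℂ) • (interp0 xa xb J (fun x => (f (τ / 2) x + f 0 x) / 2) : Grid J)

/-- `Φ^{n+1/2}`: `Φ^{1/2} = g(|γ_δ(V^{1/2})|²)` and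
`Φ^{n+1/2} = 2 g(|γ_δ(Vⁿ)|²) - Φ^{n-1/2}` for `n ≥ 1`. -/
def relaxPhi {J : ℕ} (g : ℝ → ℝ) {δ : ℝ} (hδ : 0 < δ) (Vh : Grid0 J) (V : ℕ → Grid0 J) :
    ℕ → Fin (J + 2) → ℝ
  | 0 => fun j => g (‖mollifier hδ ((Vh : Grid J) j)‖ ^ 2)
  | n + 1 => fun j =>
      2 * g (‖mollifier hδ ((V (n + 1) : Grid J) j)‖ ^ 2) - relaxPhi g hδ Vh V n j

/-- The nonlinear equation that determines `V^{n+1}` from `Vⁿ` and `Φ^{n+1/2}`, with time step `τ`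
and `t_n = n τ`. -/
def StepEq (xa xb : ℝ) (J : ℕ) (g : ℝ → ℝ) (f : ℝ → ℝ → ℂ) {δ : ℝ} (hδ : 0 < δ) (τ : ℝ)
    (Vh : Grid0 J) (V : ℕ → Grid0 J) (n : ℕ) : Prop :=
  (V (n + 1) : Grid J) - (V n : Grid J)
    = (Complex.I * (τ : ℂ)) •
        (discLaplacian J (meshWidth xa xb J) ((1 / 2 : ℂ) • (V (n + 1) + V n)) : Grid J)
      + (Complex.I * (τ : ℂ)) •
        ((fun j => (cutoff hδ (relaxPhi g hδ Vh V n j) : ℂ)) *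
          (fun j => mollifier hδ ((((1 / 2 : ℂ) • (V (n + 1) + V n) : Grid0 J) : Grid J) j)))
      + (τ : ℂ) • (interp0 xa xb J
          (fun x => (f (((n + 1 : ℕ) : ℝ) * τ) x + f ((n : ℝ) * τ) x) / 2) : Grid J)

end MRFD

end

/-! In one space dimension a Crank–Nicolson step can be solved by shooting. The midpoint `W = (U +
V) / 2` satisfies `w (j + 2) = (q j + i κ) w (j + 1) - w j + G j (w (j + 1))` with `q`, `κ` real and
`κ = -2 h² / σ ≠ 0` for every step size `σ ≠ 0`. Start from `w 0 = 0`, `w 1 = s`; the task is to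
find `s` with `w (J + 1) = 0`. Since `γ_δ` is continuous and bounded, the end value is a continuous
function of `s` at bounded distance from `a * s`, where `a` is the end value of the homogeneous
solution with `w 1 = 1`. A discrete flux identity (`eq_zero_of_threeTerm`) gives `a ≠ 0`, and a
winding number argument (`Complex.exists_eq_zero_of_norm_sub_mul_le`) then gives a zero.

The half step is the case of a source independent of the unknown. Its uniqueness is the same flux
identity, applied to the difference of two solutions. -/

/-! ### Zeros of perturbed linear maps of the plane -/

open Complex in
/-- A continuous map of the plane at bounded distance from an invertible linear one has a zero. -/
theorem Complex.exists_eq_zero_of_norm_sub_mul_le {P : ℂ → ℂ} (hP : Continuous P) {a : ℂ}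
    (ha : a ≠ 0) {B : ℝ} (hB : ∀ s, ‖P s - a * s‖ ≤ B) : ∃ s, P s = 0 := by
  -- The plane is simply connected, so a zero-free `P` has a continuous logarithm `Q`.
  by_contra! hne
  obtain ⟨Q, hQc, hQ⟩ := exists_continuousOn_eqOn_exp_comp (X := ℂ) (U := Set.univ)
    (by
      have := (convex_univ (𝕜 := ℝ) (E := ℂ)).contractibleSpace Set.univ_nonempty
      exact SimplyConnectedSpace.ofContractible (Set.univ : Set ℂ))
    isOpen_univ hP.continuousOn (by rintro ⟨s, -, hs⟩; exact hne s hs)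
  replace hQc : Continuous Q := continuousOn_univ.1 hQc
  replace hQ : ∀ s, exp (Q s) = P s := fun s => hQ (Set.mem_univ s)
  have hB0 : 0 ≤ B := (norm_nonneg _).trans (hB 0)
  have ha' : 0 < ‖a‖ := norm_pos_iff.2 ha
  -- On the circle of radius `R`, `‖a * s‖ = B + 1 > B`, so `P s / (a * s)` lies within distance
  -- less than 1 of 1, where the principal logarithm is continuous.
  set R : ℝ := (B + 1) / ‖a‖ with hR
  have hRpos : 0 < R := by positivity
  let c : ℝ → ℂ := fun θ => R * exp (θ * I)
  have hc : Continuous c := by fun_prop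
  have hcn : ∀ θ, ‖c θ‖ = R := fun θ => by
    simp [c, norm_exp_ofReal_mul_I, abs_of_pos hRpos]
  have hac : ∀ θ, a * c θ ≠ 0 := fun θ =>
    mul_ne_zero ha (norm_pos_iff.1 (by rw [hcn]; exact hRpos))
  have hslit : ∀ θ, P (c θ) / (a * c θ) ∈ slitPlane := fun θ => by
    have h1 : P (c θ) / (a * c θ) = 1 + (P (c θ) - a * c θ) / (a * c θ) := by
      rw [sub_div, div_self (hac θ)]
      ring
    rw [h1]
    apply mem_slitPlane_of_norm_lt_one
    rw [norm_div, norm_mul, hcn, hR, mul_div_cancel₀ _ ha'.ne', div_lt_one (by linarith)]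
    linarith [hB (c θ)]
  let l : ℝ → ℂ := fun θ => Q (c θ) - log (P (c θ) / (a * c θ))
  have hl : Continuous l := by
    refine (hQc.comp hc).sub (Continuous.clog ?_ hslit)
    exact (hP.comp hc).div (continuous_const.mul hc) hac
  have hexpl : ∀ θ, exp (l θ) = a * c θ := fun θ => by
    have h2 := hne (c θ)
    rw [exp_sub, hQ, exp_log (div_ne_zero h2 (hac θ))]
    field_simp [hac θ]
  -- Both sides lift `θ ↦ a * c θ` through `exp` and agree at 0. But `l` has period `2π` and the
  -- right side does not.
  have heq : l = fun θ : ℝ => l 0 + θ * I := by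
    refine isCoveringMap_exp.eq_of_comp_eq hl (by fun_prop) ?_ 0 (by simp)
    ext θ
    simp only [Function.comp_apply, exp_add, hexpl]
    simp [c, mul_assoc]
  have h2pi := congrFun heq (2 * Real.pi)
  have hper : l (2 * Real.pi) = l 0 := by simp [l, c, exp_two_pi_mul_I]
  rw [hper] at h2pi
  simp [Real.pi_ne_zero] at h2pi

/-! ### Three-term recurrences and shooting -/

/-- A solution of a three-term recurrence with real potential and nonzero constant absorption that
vanishes at both ends vanishes in between. -/
theorem eq_zero_of_threeTerm {J : ℕ} {q : ℕ → ℝ} {κ : ℝ} (hκ : κ ≠ 0) {a : ℕ → ℂ}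
    (h0 : a 0 = 0)
    (hrec : ∀ j < J, a (j + 2) = (q j + Complex.I * κ) * a (j + 1) - a j)
    (hJ : a (J + 1) = 0) : ∀ j ≤ J + 1, a j = 0 := by
  -- Discrete flux: the real potential drops out of the imaginary part, so each step adds only `κ |a
  -- (k + 1)|²`. The flux vanishes at `k = J` by the end condition.
  have key : ∀ k ≤ J, (starRingEnd ℂ (a k) * a (k + 1)).im
      = κ * ∑ j ∈ Finset.range (k + 1), Complex.normSq (a j) := by
    intro k
    induction k with
    | zero => simp [h0]
    | succ k ih =>
      intro hk
      rw [Finset.sum_range_succ, mul_add, ← ih (by omega), hrec k (by omega)]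
      simp only [Complex.mul_im, Complex.sub_im, Complex.mul_re, Complex.sub_re, Complex.add_re,
        Complex.add_im, Complex.conj_re, Complex.conj_im, Complex.ofReal_re, Complex.ofReal_im,
        Complex.I_re, Complex.I_im, Complex.normSq_apply]
      ring
  have hsum : ∑ j ∈ Finset.range (J + 1), Complex.normSq (a j) = 0 := by
    have := key J le_rfl
    rw [hJ, mul_zero, Complex.zero_im] at this
    exact (mul_eq_zero.1 this.symm).resolve_left hκ
  intro j hj
  rcases hj.eq_or_lt with rfl | hj
  · exact hJ
  · exact Complex.normSq_eq_zero.1 ((Finset.sum_eq_zero_iff_of_nonneg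
      fun i _ => Complex.normSq_nonneg (a i)).1 hsum j (Finset.mem_range.2 hj))

/-- The solution of a three-term recurrence with initial values `0` and `s`. -/
def shoot (b : ℕ → ℂ) (G : ℕ → ℂ → ℂ) (s : ℂ) : ℕ → ℂ
  | 0 => 0
  | 1 => s
  | j + 2 => b j * shoot b G s (j + 1) - shoot b G s j + G j (shoot b G s (j + 1))

theorem continuous_shoot {b : ℕ → ℂ} {G : ℕ → ℂ → ℂ} (hG : ∀ j, Continuous (G j)) :
    ∀ j, Continuous fun s => shoot b G s j
  | 0 => continuous_const
  | 1 => continuous_id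
  | j + 2 => by
    have h1 := continuous_shoot (b := b) hG (j + 1)
    have h0 := continuous_shoot (b := b) hG j
    have h2 := (hG j).comp h1
    exact ((continuous_const.mul h1).sub h0).add h2

/-- By linearity `shoot b 0 1 j * s` is the homogeneous solution with initial values `0`, `s`. The
error obeys the same recurrence with a bounded source, so it stays bounded uniformly in `s` at each
index. -/
theorem exists_norm_shoot_sub_le {b : ℕ → ℂ} {G : ℕ → ℂ → ℂ} (hG : ∀ j, ∃ B, ∀ z, ‖G j z‖ ≤ B) :
    ∀ j, ∃ B, ∀ s, ‖shoot b G s j - shoot b 0 1 j * s‖ ≤ B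
  | 0 => ⟨0, fun s => by simp [shoot]⟩
  | 1 => ⟨0, fun s => by simp [shoot]⟩
  | j + 2 => by
    obtain ⟨B1, h1⟩ := exists_norm_shoot_sub_le (b := b) hG (j + 1)
    obtain ⟨B0, h0⟩ := exists_norm_shoot_sub_le (b := b) hG j
    obtain ⟨B, hB⟩ := hG j
    refine ⟨‖b j‖ * B1 + B0 + B, fun s => ?_⟩
    have : shoot b G s (j + 2) - shoot b 0 1 (j + 2) * s
        = b j * (shoot b G s (j + 1) - shoot b 0 1 (j + 1) * s)
          - (shoot b G s j - shoot b 0 1 j * s) + G j (shoot b G s (j + 1)) := by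
      simp only [shoot, Pi.zero_apply]
      ring
    rw [this]
    refine (norm_add_le _ _).trans (add_le_add ((norm_sub_le _ _).trans
      (add_le_add ?_ (h0 s))) (hB _))
    rw [norm_mul]
    exact mul_le_mul_of_nonneg_left (h1 s) (norm_nonneg _)

/-- A two-point boundary value problem for a three-term recurrence with a bounded continuous
nonlinearity is solvable. -/
theorem exists_threeTerm (J : ℕ) (q : ℕ → ℝ) {κ : ℝ} (hκ : κ ≠ 0) {G : ℕ → ℂ → ℂ}
    (hGc : ∀ j, Continuous (G j)) (hGb : ∀ j, ∃ B, ∀ z, ‖G j z‖ ≤ B) :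
    ∃ w : ℕ → ℂ, w 0 = 0 ∧ w (J + 1) = 0 ∧
      ∀ j, w (j + 2) = (q j + Complex.I * κ) * w (j + 1) - w j + G j (w (j + 1)) := by
  let b : ℕ → ℂ := fun j => q j + Complex.I * κ
  have ha : shoot b 0 1 (J + 1) ≠ 0 := fun h => by
    have := eq_zero_of_threeTerm (q := q) hκ (a := shoot b 0 1) rfl
      (fun j _ => by simp [shoot, b]) h 1 (by omega)
    simp [shoot] at this
  obtain ⟨B, hB⟩ := exists_norm_shoot_sub_le (b := b) hGb (J + 1)
  obtain ⟨s, hs⟩ := Complex.exists_eq_zero_of_norm_sub_mul_le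
    (continuous_shoot (b := b) hGc (J + 1)) ha hB
  exact ⟨shoot b G s, rfl, hs, fun j => rfl⟩

/-! ### Continuity and boundedness of the mollifier -/

namespace MRFD

theorem continuous_cutoffPos {δ : ℝ} (hδ : 0 < δ) : Continuous (cutoffPos hδ) := by
  have hp := isTransition_transitionPoly hδ
  refine Continuous.if_le continuous_id (Continuous.if_le (transitionPoly hδ).continuous
    continuous_const continuous_id continuous_const ?_) continuous_id continuous_const ?_
  · rintro x rfl
    exact hp.right0
  · rintro x rfl
    rw [if_pos (by linarith), hp.left0]

theorem continuous_cutoff {δ : ℝ} (hδ : 0 < δ) : Continuous (cutoff hδ) := by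
  refine Continuous.if_le (continuous_cutoffPos hδ) ((continuous_cutoffPos hδ).comp
    continuous_neg).neg continuous_const continuous_id ?_
  rintro x rfl
  simp [cutoffPos, hδ.le]

theorem cutoff_zero {δ : ℝ} (hδ : 0 < δ) : cutoff hδ 0 = 0 := by
  simp [cutoff, cutoffPos, hδ.le]

theorem exists_abs_cutoff_le {δ : ℝ} (hδ : 0 < δ) : ∃ B, ∀ x, |cutoff hδ x| ≤ B := by
  obtain ⟨B, hB⟩ := (isCompact_Icc (a := 0) (b := 2 * δ)).exists_bound_of_continuousOn
    (continuous_cutoffPos hδ).continuousOn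
  have hpos : ∀ x, 0 ≤ x → |cutoffPos hδ x| ≤ max B (2 * δ) := fun x hx => by
    rcases le_or_gt x (2 * δ) with h | h
    · exact (hB x ⟨hx, h⟩).trans (le_max_left _ _)
    · rw [cutoffPos, if_neg (by linarith), if_neg h.not_ge, abs_of_pos (by linarith)]
      exact le_max_right _ _
  refine ⟨max B (2 * δ), fun x => ?_⟩
  rw [cutoff]
  split_ifs with h
  · exact hpos x h
  · rw [abs_neg]
    exact hpos (-x) (by linarith)

theorem continuous_mollifier {δ : ℝ} (hδ : 0 < δ) : Continuous (mollifier hδ) := by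
  have := continuous_cutoff hδ
  unfold mollifier
  fun_prop

theorem mollifier_zero {δ : ℝ} (hδ : 0 < δ) : mollifier hδ 0 = 0 := by
  simp [mollifier, cutoff_zero]

theorem exists_norm_mollifier_le {δ : ℝ} (hδ : 0 < δ) : ∃ B, ∀ z, ‖mollifier hδ z‖ ≤ B := by
  obtain ⟨B, hB⟩ := exists_abs_cutoff_le hδ
  refine ⟨B + B, fun z => (norm_add_le _ _).trans (add_le_add ?_ ?_)⟩
  · simpa using hB z.re
  · simpa using hB z.im

/-! ### Crank–Nicolson steps as boundary value problems -/

/-- The Crank–Nicolson equation for `U`, with real potential `p` and nonlinear source `G`. -/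
def MidpointEq {J : ℕ} (h σ : ℝ) (p : Fin (J + 2) → ℝ) (G : Fin (J + 2) → ℂ → ℂ)
    (V U : Grid0 J) : Prop :=
  ∀ j, (U : Grid J) j - (V : Grid J) j
    = Complex.I * σ * (discLaplacian J h ((1 / 2 : ℂ) • (U + V)) : Grid J) j
      + Complex.I * σ * (p j * (((1 / 2 : ℂ) • (U + V) : Grid0 J) : Grid J) j)
      + G j ((((1 / 2 : ℂ) • (U + V) : Grid0 J) : Grid J) j)

theorem discLaplacian_apply_interior {J : ℕ} (h : ℝ) (W : Grid0 J) {j : ℕ} (hj : j < J) :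
    (discLaplacian J h W : Grid J) ⟨j + 1, by omega⟩
      = ((W : Grid J) ⟨j, by omega⟩ - 2 * (W : Grid J) ⟨j + 1, by omega⟩
        + (W : Grid J) ⟨j + 2, by omega⟩) / (h : ℂ) ^ 2 := by
  have h0 : 0 < (⟨j + 1, by omega⟩ : Fin (J + 2)) := Nat.succ_pos j
  simp [discLaplacian, extendByZero, hj, h0]

theorem forall_grid_iff {J : ℕ} {Q : Fin (J + 2) → Prop} :
    (∀ j, Q j) ↔ Q 0 ∧ Q (Fin.last (J + 1)) ∧ ∀ (j : ℕ) (hj : j < J), Q ⟨j + 1, by omega⟩ := by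
  refine ⟨fun H => ⟨H _, H _, fun _ _ => H _⟩, fun ⟨h0, hl, hi⟩ j => ?_⟩
  obtain ⟨j, hj⟩ := j
  rcases j with _ | j
  · exact h0
  · rcases (Nat.le_of_lt_succ (Nat.lt_of_succ_lt_succ hj)).lt_or_eq with hj' | rfl
    · exact hi j hj'
    · exact hl

/-- The Crank–Nicolson equation as a three-term recurrence for the midpoint. -/
theorem midpointEq_iff {J : ℕ} {h σ : ℝ} (hh : h ≠ 0) (hσ : σ ≠ 0) {p : Fin (J + 2) → ℝ}
    {G : Fin (J + 2) → ℂ → ℂ} (hG0 : G 0 0 = 0) (hGl : G (Fin.last (J + 1)) 0 = 0)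
    {V U W : Grid0 J} (hW : (1 / 2 : ℂ) • (U + V) = W) :
    MidpointEq h σ p G V U ↔ ∀ (j : ℕ) (hj : j < J), (W : Grid J) ⟨j + 2, by omega⟩
      = (((2 - h ^ 2 * p ⟨j + 1, by omega⟩ : ℝ) : ℂ) + Complex.I * ((-2 * h ^ 2 / σ : ℝ) : ℂ))
          * (W : Grid J) ⟨j + 1, by omega⟩ - (W : Grid J) ⟨j, by omega⟩
        + Complex.I * h ^ 2 / σ * (2 * (V : Grid J) ⟨j + 1, by omega⟩
          + G ⟨j + 1, by omega⟩ ((W : Grid J) ⟨j + 1, by omega⟩)) := by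
  have hU : ∀ j, (U : Grid J) j = 2 * (W : Grid J) j - (V : Grid J) j := fun j => by
    rw [← hW]
    simp only [Submodule.coe_smul, Submodule.coe_add, Pi.smul_apply, Pi.add_apply, smul_eq_mul]
    ring
  have hh' : (h : ℂ) ≠ 0 := by exact_mod_cast hh
  have hσ' : (σ : ℂ) ≠ 0 := by exact_mod_cast hσ
  rw [MidpointEq, forall_grid_iff, hW]
  have e0 : ∀ X : Grid0 J, (X : Grid J) 0 = 0 := fun X => X.2.1
  have el : ∀ X : Grid0 J, (X : Grid J) (Fin.last (J + 1)) = 0 := fun X => X.2.2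
  -- At the two end nodes every term vanishes, so only the interior equations remain.
  simp only [e0, el, hG0, hGl, mul_zero, sub_zero, add_zero, true_and]
  refine forall₂_congr fun j hj => ?_
  rw [discLaplacian_apply_interior h W hj, hU]
  push_cast
  generalize (W : Grid J) ⟨j + 2, _⟩ = w2
  generalize (W : Grid J) ⟨j, _⟩ = w0
  generalize G _ _ = γ
  generalize (W : Grid J) ⟨j + 1, _⟩ = w1
  generalize (V : Grid J) ⟨j + 1, _⟩ = v
  have hI := Complex.I_sq
  constructor <;> intro H <;> field_simp at H ⊢
  · linear_combination Complex.I * H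
      + σ * (w2 + w0 - 2 * w1 + h ^ 2 * p ⟨j + 1, by omega⟩ * w1) * hI
  · linear_combination (-Complex.I) * H + h ^ 2 * (2 * w1 - 2 * v - γ) * hI

theorem exists_midpointEq {J : ℕ} {h σ : ℝ} (hh : h ≠ 0) (hσ : σ ≠ 0) (p : Fin (J + 2) → ℝ)
    {G : Fin (J + 2) → ℂ → ℂ} (hG0 : G 0 0 = 0) (hGl : G (Fin.last (J + 1)) 0 = 0)
    (hGc : ∀ j, Continuous (G j)) (hGb : ∀ j, ∃ B, ∀ z, ‖G j z‖ ≤ B) (V : Grid0 J) :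
    ∃ U, MidpointEq h σ p G V U := by
  -- `exists_threeTerm` wants coefficients for all natural indices; the wrapped values for `j > J`
  -- are irrelevant, as only `j < J` is used.
  let i : ℕ → Fin (J + 2) := fun j => Fin.ofNat (J + 2) (j + 1)
  have hi : ∀ j (hj : j < J), i j = ⟨j + 1, by omega⟩ := fun j hj => by
    ext
    exact Nat.mod_eq_of_lt (by omega)
  obtain ⟨w, hw0, hwl, hw⟩ := exists_threeTerm J (fun j => 2 - h ^ 2 * p (i j))
    (κ := -2 * h ^ 2 / σ) (by simp [hh, hσ])
    (G := fun j z => Complex.I * h ^ 2 / σ * (2 * (V : Grid J) (i j) + G (i j) z))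
    (fun j => continuous_const.mul (continuous_const.add (hGc _)))
    (fun j => by
      obtain ⟨B, hB⟩ := hGb (i j)
      refine ⟨‖Complex.I * h ^ 2 / σ‖ * (‖2 * (V : Grid J) (i j)‖ + B), fun z => ?_⟩
      rw [norm_mul]
      gcongr
      exact (norm_add_le _ _).trans (by gcongr; exact hB z))
  let W : Grid0 J := ⟨fun j => w j, by simpa using hw0, by simpa using hwl⟩
  refine ⟨(2 : ℂ) • W - V, (midpointEq_iff hh hσ hG0 hGl (W := W) (by simp)).2 fun j hj => ?_⟩
  have := hw j
  simp only [hi j hj] at this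
  exact this

/-- A source independent of the unknown cancels in the difference of two midpoints, which leaves the
homogeneous recurrence with zero end values. -/
theorem MidpointEq.unique {J : ℕ} {h σ : ℝ} (hh : h ≠ 0) (hσ : σ ≠ 0) {p : Fin (J + 2) → ℝ}
    {F : Fin (J + 2) → ℂ} (hF0 : F 0 = 0) (hFl : F (Fin.last (J + 1)) = 0) {V U U' : Grid0 J}
    (hU : MidpointEq h σ p (fun j _ => F j) V U) (hU' : MidpointEq h σ p (fun j _ => F j) V U') :
    U = U' := by
  rw [midpointEq_iff hh hσ hF0 hFl rfl] at hU hU'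
  set W : Grid0 J := (1 / 2 : ℂ) • (U + V) with hW
  set W' : Grid0 J := (1 / 2 : ℂ) • (U' + V) with hW'
  let d : ℕ → ℂ := fun j => if hj : j < J + 2 then (W - W' : Grid J) ⟨j, hj⟩ else 0
  let q : ℕ → ℝ := fun j => if hj : j + 1 < J + 2 then 2 - h ^ 2 * p ⟨j + 1, hj⟩ else 0
  have hd : ∀ j (hj : j < J + 2), d j = (W : Grid J) ⟨j, hj⟩ - (W' : Grid J) ⟨j, hj⟩ :=
    fun j hj => dif_pos hj
  have hz := eq_zero_of_threeTerm (J := J) (q := q) (κ := -2 * h ^ 2 / σ) (by simp [hh, hσ])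
    (a := d) ((hd 0 (by omega)).trans (sub_eq_zero.2 (W.2.1.trans W'.2.1.symm)))
    (fun j hj => by
      have hq : q j = 2 - h ^ 2 * p ⟨j + 1, by omega⟩ := dif_pos (by omega)
      rw [hd _ (by omega), hd _ (by omega), hd _ (by omega), hq, hU j hj, hU' j hj]
      ring)
    ((hd _ (by omega)).trans (sub_eq_zero.2 (W.2.2.trans W'.2.2.symm)))
  have hWW : W = W' := by
    ext j
    have h1 := hz j (by omega)
    rw [hd _ j.2] at h1
    exact sub_eq_zero.1 h1
  have := smul_right_injective (Grid0 J) (one_div_ne_zero (two_ne_zero (α := ℂ))) hWW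
  exact add_right_cancel this

/-! ### The steps of the scheme -/

theorem halfStepEq_iff {xa xb : ℝ} {J : ℕ} {g : ℝ → ℝ} {f : ℝ → ℝ → ℂ} {u₀ : ℝ → ℂ} {τ : ℝ}
    {V0 Vh : Grid0 J} : HalfStepEq xa xb J g f u₀ τ V0 Vh ↔
      MidpointEq (meshWidth xa xb J) (τ / 2) (fun j => g (‖interp xa xb J u₀ j‖ ^ 2))
        (fun j _ => (τ / 2 : ℂ) * (interp0 xa xb J (fun x => (f (τ / 2) x + f 0 x) / 2) : Grid J) j)
        V0 Vh := by
  simp only [HalfStepEq, MidpointEq, funext_iff, Pi.sub_apply, Pi.add_apply, Pi.smul_apply,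
    Pi.mul_apply, smul_eq_mul]
  push_cast
  rfl

/-- One step of the scheme is solvable. -/
theorem exists_step {xa xb : ℝ} (hab : xa < xb) {J : ℕ} {δ : ℝ} (hδ : 0 < δ) {τ : ℝ} (hτ : τ ≠ 0)
    (φ : Fin (J + 2) → ℝ) (z : ℝ → ℂ) (V : Grid0 J) : ∃ U : Grid0 J,
    (U : Grid J) - (V : Grid J)
      = (Complex.I * (τ : ℂ)) •
          (discLaplacian J (meshWidth xa xb J) ((1 / 2 : ℂ) • (U + V)) : Grid J)
        + (Complex.I * (τ : ℂ)) • ((fun j => (cutoff hδ (φ j) : ℂ)) *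
          (fun j => mollifier hδ ((((1 / 2 : ℂ) • (U + V) : Grid0 J) : Grid J) j)))
        + (τ : ℂ) • (interp0 xa xb J z : Grid J) := by
  obtain ⟨B, hB⟩ := exists_norm_mollifier_le hδ
  have hc := continuous_mollifier hδ
  -- The potential is taken to be 0: the whole mollified term goes into `G`, where its coefficient
  -- is a fixed number at each node.
  obtain ⟨U, hU⟩ := exists_midpointEq (meshWidth_pos hab J).ne' hτ 0
    (G := fun j w => Complex.I * τ * (cutoff hδ (φ j) * mollifier hδ w)
      + τ * (interp0 xa xb J z : Grid J) j)
    (by simp [mollifier_zero, (interp0 xa xb J z).2.1])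
    (by simp [mollifier_zero, (interp0 xa xb J z).2.2])
    (fun j => by fun_prop)
    (fun j => ⟨‖Complex.I * τ‖ * (‖(cutoff hδ (φ j) : ℂ)‖ * B)
        + ‖τ * (interp0 xa xb J z : Grid J) j‖, fun w => by
      refine (norm_add_le _ _).trans ?_
      rw [norm_mul, norm_mul _ (mollifier hδ w)]
      gcongr
      exact hB w⟩) V
  refine ⟨U, funext fun j => ?_⟩
  have := hU j
  simp only [Pi.zero_apply, Complex.ofReal_zero, zero_mul, mul_zero, add_zero] at this
  simpa only [Pi.sub_apply, Pi.add_apply, Pi.smul_apply, Pi.mul_apply, smul_eq_mul, add_assoc]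
    using this

end MRFD

theorem mainTheorem5
    (T xa xb : ℝ) (hT : 0 < T) (hab : xa < xb)
    (g : ℝ → ℝ) (hg : ContinuousOn g (Set.Ici 0))
    (f : ℝ → ℝ → ℂ)
    (hf : ContinuousOn (fun q : ℝ × ℝ => f q.1 q.2) (Set.Icc 0 T ×ˢ Set.Icc xa xb))
    (u₀ : ℝ → ℂ) (hu₀ : ContDiffOn ℝ 2 u₀ (Set.Icc xa xb))
    (hu₀a : u₀ xa = 0) (hu₀b : u₀ xb = 0)
    (N J : ℕ) (hN : 0 < N) (hJ : 0 < J)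
    (δ : ℝ) (hδ : 0 < δ) :
    (∃! Vh : MRFD.Grid0 J,
      MRFD.HalfStepEq xa xb J g f u₀ (T / N) (MRFD.ellipticProj hab J u₀) Vh) ∧
    ∀ Vh : MRFD.Grid0 J,
      MRFD.HalfStepEq xa xb J g f u₀ (T / N) (MRFD.ellipticProj hab J u₀) Vh →
      ∃ V : ℕ → MRFD.Grid0 J,
        V 0 = MRFD.ellipticProj hab J u₀ ∧
        ∀ n < N, MRFD.StepEq xa xb J g f hδ (T / N) Vh V n := by
  have hτ : T / N ≠ 0 := by positivity
  have hh := (MRFD.meshWidth_pos hab J).ne'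
  refine ⟨?_, fun Vh _ => ?_⟩
  · have h0 : ∀ (c : ℂ) (X : MRFD.Grid0 J), c * (X : MRFD.Grid J) 0 = 0 := fun c X => by
      rw [X.2.1, mul_zero]
    have hl : ∀ (c : ℂ) (X : MRFD.Grid0 J), c * (X : MRFD.Grid J) (Fin.last (J + 1)) = 0 :=
      fun c X => by rw [X.2.2, mul_zero]
    simp only [MRFD.halfStepEq_iff]
    exact existsUnique_of_exists_of_unique
      (MRFD.exists_midpointEq hh (div_ne_zero hτ two_ne_zero) _ (h0 _ _) (hl _ _)
        (fun _ => continuous_const) (fun _ => ⟨_, fun _ => le_rfl⟩) _)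
      (fun _ _ => MRFD.MidpointEq.unique hh (div_ne_zero hτ two_ne_zero) (h0 _ _) (hl _ _))
  · choose step hstep using fun (φ : Fin (J + 2) → ℝ) (z : ℝ → ℂ) (V : MRFD.Grid0 J) =>
      MRFD.exists_step hab hδ hτ φ z V
    let src : ℕ → ℝ → ℂ := fun n x =>
      (f (((n + 1 : ℕ) : ℝ) * (T / N)) x + f ((n : ℝ) * (T / N)) x) / 2
    -- The recursion carries the pair `(Vⁿ, Φ^{n+1/2})`, because `V^{n+1}` needs `Φ^{n+1/2}` and
    -- `Φ^{n+3/2}` needs both `V^{n+1}` and `Φ^{n+1/2}`.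
    let s : ℕ → MRFD.Grid0 J × (Fin (J + 2) → ℝ) := fun n => Nat.rec
      (MRFD.ellipticProj hab J u₀, fun j => g (‖MRFD.mollifier hδ ((Vh : MRFD.Grid J) j)‖ ^ 2))
      (fun n s => (step s.2 (src n) s.1, fun j =>
        2 * g (‖MRFD.mollifier hδ ((step s.2 (src n) s.1 : MRFD.Grid J) j)‖ ^ 2) - s.2 j)) n
    have hs : ∀ n, MRFD.relaxPhi g hδ Vh (fun n => (s n).1) n = (s n).2 := by
      intro n
      induction n with
      | zero => rfl
      | succ n ih =>
        rw [MRFD.relaxPhi, ih]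
    refine ⟨fun n => (s n).1, rfl, fun n _ => ?_⟩
    rw [MRFD.StepEq, hs]
    exact hstep (s n).2 (src n) (s n).1
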